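/- For a prime $p$, let $\mathbf{H}_p=\mathbf{G}_p*\mathbf{Ab}_{p-1}$ be the class of all finite groups $G$ having a normal $p$-subgroup $N$ such that $G/N$ is abelian of exponent dividing $p-1$. The pro-$\mathbf{H}_p$ topology on a free group $F$ is the topology having as a basis all cosets $Kx$, where $x\in F$ and $K$ is a normal subgroup of $F$ with $F/K\in\mathbf{H}_p$; a subgroup $H\le F$ is called $\mathbf{H}_p$-dense if its closure in this topology is $F$. It is decidable whether a finitely generated subgroup $H$ of a free group $F$ of finite rank is $\mathbf{H}_p$-dense. That is, there is an algorithm (a total computable function) which, given a prime $p$, a natural number $n$ and a finite list of words $w_1,\dots,w_k$ over the letters $a_1^{\pm1},\dots,a_n^{\pm1}$, decides whether the subgroup $H=\langle w_1,\dots,w_k\rangle$ of the free group $F=F(a_1,\dots,a_n)$ is $\mathbf{H}_p$-dense in $F$. -/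

import Mathlib

universe u

namespace ProV

/-- A class of groups, given by its membership predicate. -/
abbrev GroupClass : Type (u + 1) := ∀ (G : Type u) [Group G], Prop

/-- The class `G_p` of all finite `p`-groups. -/
def finPGroups (p : ℕ) : GroupClass.{u} :=
  fun G _ => Finite G ∧ IsPGroup p G

/-- The class `Ab_d` of all finite abelian groups of exponent dividing `d`. -/
def finAbelian (d : ℕ) : GroupClass.{u} :=
  fun G _ => Finite G ∧ (∀ x y : G, x * y = y * x) ∧ ∀ x : G, x ^ d = 1

/-- The product `U * V`: all groups `G` with a normal subgroup `N` in `U` such that `G ⧸ N` is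
in `V`. -/
def product (U V : GroupClass.{u}) : GroupClass.{u} :=
  fun G _ => ∃ (N : Subgroup G) (_ : N.Normal), U N ∧ V (G ⧸ N)

/-- The class `H_p = G_p * Ab_{p-1}`. -/
def classH (p : ℕ) : GroupClass.{u} :=
  product (finPGroups p) (finAbelian (p - 1))

/-- The pro-`V` topology on a group `F`, generated by the cosets `Kx` of the normal subgroups `K`
of `F` such that `F ⧸ K` is in `V`. -/
@[reducible] def proTopology (V : GroupClass.{u}) (F : Type u) [Group F] : TopologicalSpace F :=
  TopologicalSpace.generateFrom
    {S | ∃ (K : Subgroup F) (_ : K.Normal) (x : F),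
      V (F ⧸ K) ∧ S = (fun k => k * x) '' (K : Set F)}

/-- The `V`-closure of a subset: its closure in the pro-`V` topology. -/
def closureIn (V : GroupClass.{u}) {F : Type u} [Group F] (S : Set F) : Set F :=
  @closure F (proTopology V F) S

/-- A subset is `V`-dense if its `V`-closure is the whole group. -/
def IsDenseIn (V : GroupClass.{u}) {F : Type u} [Group F] (S : Set F) : Prop :=
  closureIn V S = Set.univ

/-- The subgroup of the free group on `n` letters generated by a finite list of words. A word is a
list of pairs `(i, ε)`, standing for the letter `i` if `ε = true` and for its inverse otherwise. -/
def subgroupOfWords {n : ℕ} (W : List (List (Fin n × Bool))) : Subgroup (FreeGroup (Fin n)) :=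
  Subgroup.closure {g | ∃ w ∈ W, FreeGroup.mk w = g}

/-- The list of words as input data for an algorithm: each letter is replaced by its number. -/
def rawWords {n : ℕ} (W : List (List (Fin n × Bool))) : List (List (ℕ × Bool)) :=
  W.map fun w => w.map fun a => ((a.1 : ℕ), a.2)

end ProV

namespace ProV

/-! Density is reduced to a finite search over affine actions on `ZMod p` (`isDenseIn_classH_iff`).
If `H` is not dense, its image in some finite quotient `G` in `H_p` lies in a maximal subgroup `M`.
Let `P` be a normal `p`-subgroup of `G` with `G / P` abelian of exponent dividing `p - 1`. If `P ≤
M`, then `M` is normal and a character with values in `(ZMod p)ˣ` separates it from `G`. Otherwise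
`M ⊓ P` is normal, and modulo it `P` is a minimal normal subgroup complemented by `M`. Eigenvectors
force `P` to have order `p`, so `G` acts affinely on `P` with `M` as the stabiliser of the origin.
Conversely, the image of any affine action is in `H_p`, so a subgroup fixing an origin that the
group moves is not dense.

In a free group of rank `n` an affine action is an arbitrary choice of `n` affine maps, and only the
generators of `H` need testing. The choices are coded by numbers below `p ^ n`, so the search is
primitive recursive. -/

/-! ### Affine actions and characters -/

/-- `G` has an affine action on `ZMod p`, given by its linear part `χ` and its translation part
`δ`, such that the subgroup `H` fixes the origin but `G` does not. -/
def HasAffineAction (p : ℕ) {G : Type*} [Group G] (H : Subgroup G) : Prop :=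
  ∃ (χ : G →* (ZMod p)ˣ) (δ : G → ZMod p),
    (∀ g h, δ (g * h) = δ g + χ g * δ h) ∧ (∀ h ∈ H, δ h = 0) ∧ ∃ g, δ g ≠ 0

theorem HasAffineAction.mono {p : ℕ} {G : Type*} [Group G] {H M : Subgroup G} (hle : H ≤ M)
    (h : HasAffineAction p M) : HasAffineAction p H := by
  obtain ⟨χ, δ, hδ, hM, hg⟩ := h
  exact ⟨χ, δ, hδ, fun x hx => hM x (hle hx), hg⟩

theorem HasAffineAction.comap {p : ℕ} {G Q : Type*} [Group G] [Group Q] {f : G →* Q}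
    (hf : Function.Surjective f) {M : Subgroup Q} (h : HasAffineAction p M) :
    HasAffineAction p (M.comap f) := by
  obtain ⟨χ, δ, hδ, hM, g, hg⟩ := h
  obtain ⟨x, rfl⟩ := hf g
  exact ⟨χ.comp f, δ ∘ f, fun a b => by simp [hδ], fun a ha => hM _ ha, x, hg⟩

/-- A character of `G` that is trivial on `M` but not on `G` gives an affine action that fixes
the point `1`, moved to the origin. -/
theorem HasAffineAction.of_character {p : ℕ} {G : Type*} [Group G] {M : Subgroup G}
    (χ : G →* (ZMod p)ˣ) (hM : ∀ m ∈ M, χ m = 1) {g : G} (hg : χ g ≠ 1) :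
    HasAffineAction p M := by
  refine ⟨χ, fun x => 1 - (χ x : ZMod p), fun a b => ?_, fun m hm => ?_, g, fun h => hg ?_⟩
  · push_cast [map_mul]; ring
  · simp [hM m hm]
  · exact Units.ext (sub_eq_zero.mp h).symm

/-- Characters with values in `(ZMod p)ˣ` separate the elements of a finite abelian group of
exponent dividing `p - 1`. -/
theorem exists_character_ne_one {p : ℕ} [Fact p.Prime] {A : Type*} [CommGroup A] [Finite A]
    (hA : ∀ x : A, x ^ (p - 1) = 1) {a : A} (ha : a ≠ 1) :
    ∃ χ : A →* (ZMod p)ˣ, χ a ≠ 1 := by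
  have hp : p - 1 ≠ 0 := by have := (Fact.out : p.Prime).two_le; omega
  have : NeZero (p - 1) := ⟨hp⟩
  have : HasEnoughRootsOfUnity (ZMod p) (p - 1) := by
    refine HasEnoughRootsOfUnity.of_card_le ?_
    have htop : rootsOfUnity (p - 1) (ZMod p) = ⊤ := by
      ext u
      simp [mem_rootsOfUnity, ZMod.units_pow_card_sub_one_eq_one]
    have e : Nat.card (rootsOfUnity (p - 1) (ZMod p)) = p - 1 := by
      rw [htop, Subgroup.card_top, Nat.card_eq_fintype_card, ZMod.card_units]
    exact e.ge
  have : HasEnoughRootsOfUnity (ZMod p) (Monoid.exponent A) :=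
    HasEnoughRootsOfUnity.of_dvd (ZMod p) (Monoid.exponent_dvd_of_forall_pow_eq_one hA)
  exact CommGroup.exists_apply_ne_one_of_hasEnoughRootsOfUnity A (ZMod p) ha

/-- Containing all commutators, `M` is normal, and a nontrivial character of the abelian group `G ⧸
M` supplies the action. -/
theorem hasAffineAction_of_le {p : ℕ} [Fact p.Prime] {G : Type*} [Group G] [Finite G]
    {P M : Subgroup G} [P.Normal] (hcomm : ∀ x y : G, x * y * x⁻¹ * y⁻¹ ∈ P)
    (hpow : ∀ x : G, x ^ (p - 1) ∈ P) (hPM : P ≤ M) (hM : M ≠ ⊤) : HasAffineAction p M := by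
  have hMn : M.Normal := ⟨fun m hm g => by
    have h := M.mul_mem (hPM (hcomm g m)) hm
    simpa using h⟩
  let _ : CommGroup (G ⧸ M) :=
    { (inferInstance : Group (G ⧸ M)) with
      mul_comm := by
        rintro ⟨x⟩ ⟨y⟩
        refine (QuotientGroup.eq (s := M)).2 ?_
        have h := hPM (hcomm y⁻¹ x⁻¹)
        simpa [mul_assoc] using h }
  obtain ⟨g, hg⟩ : ∃ g, g ∉ M := by
    by_contra! h
    exact hM (eq_top_iff.2 fun x _ => h x)
  obtain ⟨χ, hχ⟩ := exists_character_ne_one (p := p) (A := G ⧸ M)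
    (by rintro ⟨x⟩; exact (QuotientGroup.eq_one_iff (N := M) (x ^ (p - 1))).2 (hPM (hpow x)))
    (a := (g : G ⧸ M)) (by rwa [Ne, QuotientGroup.eq_one_iff])
  refine HasAffineAction.of_character (χ.comp (QuotientGroup.mk' M)) (fun m hm => ?_) hχ
  have : (m : G ⧸ M) = 1 := (QuotientGroup.eq_one_iff _).2 hm
  simp [this]

/-! ### Eigenvectors and minimal normal subgroups -/

/-- An endomorphism of finite order dividing `p - 1` of a nontrivial finite `ZMod p`-vector space
has an eigenvector. -/
theorem exists_eigenvector_of_pow_eq_one {p : ℕ} [Fact p.Prime] {V : Type*} [AddCommGroup V]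
    [Module (ZMod p) V] [Finite V] [Nontrivial V] (T : Module.End (ZMod p) V)
    (hT : T ^ (p - 1) = 1) :
    ∃ (a : ZMod p) (v : V), v ≠ 0 ∧ T v = a • v := by
  have hp := (Fact.out : p.Prime)
  -- Hence `X ^ p - X`, which splits over `ZMod p`, annihilates `T`, and the minimal polynomial has
  -- a root.
  have hTp : T ^ p = T := by
    rw [← pow_sub_mul_pow T hp.one_le, hT, one_mul, pow_one]
  have hsplit : (Polynomial.X ^ p - Polynomial.X : Polynomial (ZMod p)).Splits := by
    have := FiniteField.splits_X_pow_card_sub_X (K := ZMod p) p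
    simpa using this
  have hne : (Polynomial.X ^ p - Polynomial.X : Polynomial (ZMod p)) ≠ 0 :=
    FiniteField.X_pow_card_sub_X_ne_zero (ZMod p) hp.one_lt
  have hdvd : minpoly (ZMod p) T ∣ Polynomial.X ^ p - Polynomial.X :=
    minpoly.dvd _ _ (by simp [hTp])
  have hs := hsplit.of_dvd hne hdvd
  obtain ⟨a, ha⟩ := hs.exists_eval_eq_zero
    (minpoly.degree_pos (Algebra.IsIntegral.isIntegral T)).ne'
  obtain ⟨v, hv⟩ := (Module.End.hasEigenvalue_of_isRoot (f := T) ha).exists_hasEigenvector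
  exact ⟨a, v, hv.2, hv.apply_eq_smul⟩

theorem exists_apply_eq_pow {p : ℕ} [Fact p.Prime] {A : Type*} [Group A] [Finite A]
    [Nontrivial A] (hab : ∀ x y : A, x * y = y * x) (hA : ∀ x : A, x ^ p = 1) (f : A →* A)
    (hf : ∀ x, f^[p - 1] x = x) :
    ∃ (a : ℕ) (v : A), v ≠ 1 ∧ f v = v ^ a := by
  let _ : CommGroup A := { ‹Group A› with mul_comm := hab }
  let _ : Module (ZMod p) (Additive A) := AddCommGroup.zmodModule hA
  let T : Module.End (ZMod p) (Additive A) := f.toAdditive.toZModLinearMap p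
  obtain ⟨a, v, hv, hav⟩ := exists_eigenvector_of_pow_eq_one T
    (LinearMap.ext fun x => by rw [Module.End.pow_apply]; exact hf x.toMul)
  refine ⟨a.val, v.toMul, hv, ?_⟩
  rw [← ZMod.natCast_zmod_val a, Nat.cast_smul_eq_nsmul] at hav
  exact hav

/-- A minimal normal `p`-subgroup `N` of a finite group `G` with `G / N` abelian of exponent
dividing `p - 1` is cyclic of order `p`. -/
theorem exists_generator_of_minimal_normal {p : ℕ} [Fact p.Prime] {G : Type*} [Group G] [Finite G]
    {N : Subgroup G} [N.Normal] (hN : IsPGroup p N) (hne : N ≠ ⊥)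
    (hmin : ∀ E : Subgroup G, E.Normal → E ≤ N → E ≠ ⊥ → N ≤ E)
    (hcomm : ∀ x y : G, x * y * x⁻¹ * y⁻¹ ∈ N) (hpow : ∀ x : G, x ^ (p - 1) ∈ N) :
    ∃ t ∈ N, t ≠ 1 ∧ t ^ p = 1 ∧ N ≤ Subgroup.zpowers t := by
  have hp : p.Prime := Fact.out
  have : Nontrivial N := (Subgroup.nontrivial_iff_ne_bot N).2 hne
  -- The center of a nontrivial `p`-group is nontrivial and characteristic, so minimality makes it
  -- all of `N`.
  have hab : ∀ x ∈ N, ∀ y ∈ N, x * y = y * x := by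
    have := hN.center_nontrivial
    have hle := hmin ((Subgroup.center N).map N.subtype) inferInstance
      (Subgroup.map_subtype_le _) (by
        rw [Ne, Subgroup.map_eq_bot_iff_of_injective _ N.subtype_injective]
        exact (Subgroup.nontrivial_iff_ne_bot _).1 this)
    intro x hx y hy
    obtain ⟨z, hz, rfl⟩ := hle hx
    exact congrArg Subtype.val (Subgroup.mem_center_iff.1 hz ⟨y, hy⟩).symm
  -- The `p`-torsion of the abelian group `N` is normal in `G`, and nontrivial by Cauchy.
  have hexp : ∀ x ∈ N, x ^ p = 1 := by
    let E : Subgroup G :=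
      { carrier := {x | x ∈ N ∧ x ^ p = 1}
        one_mem' := ⟨N.one_mem, one_pow p⟩
        mul_mem' := fun {x y} hx hy => ⟨N.mul_mem hx.1 hy.1, by
          rw [Commute.mul_pow (hab x hx.1 y hy.1), hx.2, hy.2, one_mul]⟩
        inv_mem' := fun {x} hx => ⟨N.inv_mem hx.1, by rw [inv_pow, hx.2, inv_one]⟩ }
    have hE : E.Normal := ⟨fun x hx g => ⟨Subgroup.Normal.conj_mem inferInstance x hx.1 g, by
      rw [conj_pow, hx.2, mul_one, mul_inv_cancel]⟩⟩
    have hdvd : p ∣ Nat.card N := by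
      obtain ⟨k, hk, hk'⟩ := hN.nontrivial_iff_card.mp inferInstance
      exact hk' ▸ dvd_pow_self p hk.ne'
    obtain ⟨z, hz⟩ := exists_prime_orderOf_dvd_card' p hdvd
    have hle := hmin E hE (fun x hx => hx.1) (fun h => by
      have hzE : (z : G) ∈ E := ⟨z.2, by
        have := pow_orderOf_eq_one z
        rw [hz] at this
        exact congrArg Subtype.val this⟩
      rw [h, Subgroup.mem_bot, OneMemClass.coe_eq_one] at hzE
      rw [hzE, orderOf_one] at hz
      exact hp.one_lt.ne hz)
    exact fun x hx => (hle hx).2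
  -- Conjugation by `g` has an eigenvector in `N`, since `g ^ (p - 1)` lies in the abelian group `N`
  -- and acts trivially. The eigenspace is normal because commutators also act trivially, so it is
  -- all of `N`.
  have hscalar : ∀ g : G, ∃ a : ℕ, ∀ x ∈ N, g * x * g⁻¹ = x ^ a := by
    intro g
    have hiter : ∀ (k : ℕ) (x : N),
        (((MulAut.conjNormal g).toMonoidHom : N →* N)^[k] x : G) = g ^ k * x * (g ^ k)⁻¹ := by
      intro k
      induction k with
      | zero => intro x; simp
      | succ k ih =>
        intro x
        rw [Function.iterate_succ_apply, ih, pow_succ]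
        simp [mul_assoc]
    obtain ⟨a, v, hv, hgv⟩ := exists_apply_eq_pow (p := p)
      (fun x y : N => Subtype.ext (hab x x.2 y y.2)) (fun x : N => Subtype.ext (hexp _ x.2))
      (MulAut.conjNormal g).toMonoidHom (fun x => Subtype.ext (by
        rw [hiter, hab _ (hpow g) _ x.2, mul_inv_cancel_right]))
    replace hgv : g * (v : G) * g⁻¹ = (v : G) ^ a := congrArg Subtype.val hgv
    let E : Subgroup G :=
      { carrier := {x | x ∈ N ∧ g * x * g⁻¹ = x ^ a}
        one_mem' := ⟨N.one_mem, by simp⟩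
        mul_mem' := fun {x y} hx hy => ⟨N.mul_mem hx.1 hy.1, by
          rw [Commute.mul_pow (hab x hx.1 y hy.1), ← hx.2, ← hy.2]; group⟩
        inv_mem' := fun {x} hx => ⟨N.inv_mem hx.1, by rw [inv_pow, ← hx.2]; group⟩ }
    have hE : E.Normal := ⟨fun x hx h => ⟨Subgroup.Normal.conj_mem inferInstance x hx.1 h, by
      have hc : h⁻¹ * g * h * g⁻¹ ∈ N := by simpa using hcomm h⁻¹ g
      have hxa := hab _ hc _ (N.pow_mem hx.1 a)
      rw [conj_pow]
      calc g * (h * x * h⁻¹) * g⁻¹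
          = h * ((h⁻¹ * g * h * g⁻¹) * (g * x * g⁻¹)) * (h⁻¹ * g * h * g⁻¹)⁻¹ * h⁻¹ := by group
        _ = h * x ^ a * h⁻¹ := by rw [hx.2, hxa]; group⟩⟩
    have hle := hmin E hE (fun x hx => hx.1) (fun h => by
      have hvE : (v : G) ∈ E := ⟨v.2, hgv⟩
      rw [h, Subgroup.mem_bot, OneMemClass.coe_eq_one] at hvE
      exact hv hvE)
    exact ⟨a, fun x hx => (hle hx).2⟩
  -- Since all of `G` acts by powers, every cyclic subgroup of `N` is normal.
  obtain ⟨t, ht, ht1⟩ := N.bot_or_exists_ne_one.resolve_left hne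
  refine ⟨t, ht, ht1, hexp t ht, hmin _ ⟨fun x hx g => ?_⟩ ?_ ?_⟩
  · obtain ⟨a, ha⟩ := hscalar g
    have hxN : x ∈ N := (Subgroup.zpowers_le.2 ht) hx
    rw [ha x hxN]
    exact Subgroup.pow_mem _ hx a
  · exact Subgroup.zpowers_le.2 ht
  · rwa [Ne, Subgroup.zpowers_eq_bot]

/-! ### Maximal subgroups as point stabilisers -/

/-- A maximal subgroup `M` that is a complement of a normal `p`-subgroup `P`, with `G / P` abelian
of exponent dividing `p - 1`, is the stabiliser of the origin in an affine action on `ZMod p`. -/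
theorem hasAffineAction_of_complement {p : ℕ} [Fact p.Prime] {G : Type*} [Group G] [Finite G]
    {P M : Subgroup G} [P.Normal] (hP : IsPGroup p P) (hcomm : ∀ x y : G, x * y * x⁻¹ * y⁻¹ ∈ P)
    (hpow : ∀ x : G, x ^ (p - 1) ∈ P) (hM : IsCoatom M) (hPM : ¬ P ≤ M) (hinf : M ⊓ P = ⊥) :
    HasAffineAction p M := by
  have hsup : ∀ E : Subgroup G, ¬ E ≤ M → M ⊔ E = ⊤ := fun E hE =>
    hM.2 _ (lt_of_le_of_ne le_sup_left fun h => hE (h ▸ le_sup_right))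
  have hfactor : ∀ E : Subgroup G, E.Normal → ¬ E ≤ M → ∀ g : G, ∃ x ∈ E, x⁻¹ * g ∈ M := by
    intro E _ hE g
    have hg : g ∈ E ⊔ M := by rw [sup_comm, hsup E hE]; trivial
    obtain ⟨x, hx, m, hm, rfl⟩ := Subgroup.mem_sup_of_normal_left.1 hg
    exact ⟨x, hx, by simpa using hm⟩
  have hbot : ∀ x ∈ M, x ∈ P → x = 1 := fun x h1 h2 => by
    have : x ∈ M ⊓ P := ⟨h1, h2⟩
    rwa [hinf, Subgroup.mem_bot] at this
  -- `P` is minimal normal: for `E ≤ P` normal and nontrivial, write `x = e * m` with `e ∈ E`; then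
  -- `m ∈ M ⊓ P` is trivial.
  obtain ⟨t, ht, ht1, htp, htP⟩ := exists_generator_of_minimal_normal hP
    (fun h => hPM (h ▸ bot_le)) (fun E hE hEP hE1 x hx => by
      have hEM : ¬ E ≤ M := fun h => hE1 ((Subgroup.eq_bot_iff_forall _).2 fun y hy =>
        hbot y (h hy) (hEP hy))
      obtain ⟨e, he, hm⟩ := hfactor E hE hEM x
      rw [← inv_mul_eq_one.1 (hbot _ hm (P.mul_mem (P.inv_mem (hEP he)) hx))]
      exact he) hcomm hpow
  have hord : orderOf t = p := orderOf_eq_prime htp ht1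
  have hzero : ∀ k : ℤ, t ^ k ∈ M → (k : ZMod p) = 0 := fun k hk => by
    rw [ZMod.intCast_zmod_eq_zero_iff_dvd, ← hord, orderOf_dvd_iff_zpow_eq_one]
    exact hbot _ hk (P.zpow_mem ht k)
  have hδ : ∀ g : G, ∃ k : ℤ, t ^ (-k) * g ∈ M := fun g => by
    obtain ⟨x, hx, hm⟩ := hfactor P inferInstance hPM g
    obtain ⟨k, rfl⟩ := htP hx
    exact ⟨k, by simpa using hm⟩
  have hχ : ∀ g : G, ∃ k : ℤ, g * t * g⁻¹ = t ^ k := fun g => by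
    obtain ⟨k, hk⟩ := htP (Subgroup.Normal.conj_mem ‹P.Normal› t ht g)
    exact ⟨k, hk.symm⟩
  -- Each `g` is `t ^ d g` times an element of `M`, and conjugates `t` to `t ^ c g`. The integers `d
  -- g`, `c g` are determined only modulo `p`, where they become the translation and linear parts.
  choose d hd using hδ
  choose c hc using hχ
  have hcpow : ∀ (g : G) (k : ℤ), g * t ^ k * g⁻¹ = t ^ (c g * k) := fun g k => by
    rw [zpow_mul, ← hc, conj_zpow]
  have huniq : ∀ k l : ℤ, t ^ k = t ^ l → (k : ZMod p) = l := fun k l h => by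
    have := hzero (k - l) (by rw [zpow_sub, h, mul_inv_cancel]; exact M.one_mem)
    rwa [Int.cast_sub, sub_eq_zero] at this
  have hduniq : ∀ (g : G) (k : ℤ), t ^ (-k) * g ∈ M → (d g : ZMod p) = k := fun g k h => by
    have := hzero (k - d g) (by
      have := M.mul_mem (hd g) (M.inv_mem h)
      have e : t ^ (-d g) * g * (t ^ (-k) * g)⁻¹ = t ^ (k - d g) := by
        rw [sub_eq_neg_add, zpow_add, zpow_neg t k]; group
      rwa [e] at this)
    rw [Int.cast_sub, sub_eq_zero] at this
    exact this.symm
  let χ : G →* ZMod p :=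
    { toFun := fun g => (c g : ZMod p)
      map_one' := by
        rw [← Int.cast_one]
        exact huniq _ _ (by rw [← hc]; simp)
      map_mul' := fun g h => by
        rw [← Int.cast_mul]
        refine huniq _ _ ?_
        rw [← hc, ← hcpow, ← hc]
        group }
  refine ⟨χ.toHomUnits, fun g => (d g : ZMod p), fun g h => ?_, fun m hm => ?_, t, ?_⟩
  · change (d (g * h) : ZMod p) = d g + c g * d h
    rw [← Int.cast_mul, ← Int.cast_add]
    refine hduniq _ _ ?_
    have h1 := M.mul_mem (hd g) (hd h)
    have e : t ^ (-d g) * g * (t ^ (-d h) * h) = t ^ (-(d g + c g * d h)) * (g * h) := by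
      have := hcpow g (-d h)
      rw [neg_add, zpow_add, neg_mul_eq_mul_neg, ← this]
      group
    rwa [e] at h1
  · change (d m : ZMod p) = 0
    rw [hduniq m 0 (by simpa using hm), Int.cast_zero]
  · change (d t : ZMod p) ≠ 0
    rw [hduniq t 1 (by simp), Int.cast_one]
    exact one_ne_zero

/-- When `P` is not contained in `M`, normalizers grow in the nilpotent group `P`, so the normalizer
of `M ⊓ P` contains `M` strictly and is `G` by maximality. Dividing by `M ⊓ P` leaves the
complemented case. -/
theorem hasAffineAction_of_isCoatom {p : ℕ} [Fact p.Prime] {G : Type*} [Group G] [Finite G]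
    {P M : Subgroup G} [P.Normal] (hP : IsPGroup p P) (hcomm : ∀ x y : G, x * y * x⁻¹ * y⁻¹ ∈ P)
    (hpow : ∀ x : G, x ^ (p - 1) ∈ P) (hM : IsCoatom M) : HasAffineAction p M := by
  by_cases hPM : P ≤ M
  · exact hasAffineAction_of_le hcomm hpow hPM hM.1
  have hconj : ∀ g y : G, y ∈ P ↔ g * y * g⁻¹ ∈ P := fun g =>
    Subgroup.mem_normalizer_iff.1 (by rw [Subgroup.normalizer_eq_top]; trivial)
  have hD : (M ⊓ P).Normal := by
    have hnc : NormalizerCondition P :=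
      have := hP.isNilpotent
      Group.normalizerCondition_of_isNilpotent
    have hlt : M.subgroupOf P < ⊤ := by
      rw [lt_top_iff_ne_top, Ne, Subgroup.subgroupOf_eq_top]
      exact hPM
    obtain ⟨x, hx, hxM⟩ := SetLike.exists_of_lt (hnc _ hlt)
    rw [Subgroup.mem_normalizer_iff] at hx
    have hxn : (x : G) ∈ Subgroup.normalizer (M ⊓ P : Subgroup G) := by
      rw [Subgroup.mem_normalizer_iff]
      intro y
      by_cases hy : y ∈ P
      · have h1 := hx ⟨y, hy⟩
        have h2 : (x : G) * y * (x : G)⁻¹ ∈ P := Subgroup.Normal.conj_mem inferInstance y hy x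
        simp only [Subgroup.mem_subgroupOf] at h1
        simpa [Subgroup.mem_inf, hy, h2] using h1
      · have h2 : (x : G) * y * (x : G)⁻¹ ∉ P := by
          rwa [← hconj]
        simp [Subgroup.mem_inf, hy, h2]
    have hMn : M ≤ Subgroup.normalizer (M ⊓ P : Subgroup G) := by
      intro m hm
      rw [Subgroup.mem_normalizer_iff]
      intro y
      have h1 : m * y * m⁻¹ ∈ M ↔ y ∈ M := by
        rw [M.mul_mem_cancel_right (M.inv_mem hm), M.mul_mem_cancel_left hm]
      have h2 : m * y * m⁻¹ ∈ P ↔ y ∈ P := (hconj m y).symm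
      rw [Subgroup.mem_inf, Subgroup.mem_inf, h1, h2]
    rw [← Subgroup.normalizer_eq_top_iff]
    refine hM.2 _ (lt_of_le_of_ne hMn fun h => hxM ?_)
    rw [Subgroup.mem_subgroupOf, h]
    exact hxn
  let π := QuotientGroup.mk' (M ⊓ P)
  have hπ : Function.Surjective π := QuotientGroup.mk'_surjective _
  have hker : π.ker = M ⊓ P := QuotientGroup.ker_mk' _
  have hcomapM : (M.map π).comap π = M := by
    rw [Subgroup.comap_map_eq, hker, sup_eq_left]; exact inf_le_left
  have hcomapP : (P.map π).comap π = P := by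
    rw [Subgroup.comap_map_eq, hker, sup_eq_left]; exact inf_le_right
  have hn : (P.map π).Normal := Subgroup.Normal.map inferInstance π hπ
  rw [← hcomapM]
  refine HasAffineAction.comap hπ (hasAffineAction_of_complement (P := P.map π) ?_ ?_ ?_ ?_ ?_ ?_)
  · exact hP.map π
  · intro x y
    obtain ⟨x, rfl⟩ := hπ x
    obtain ⟨y, rfl⟩ := hπ y
    exact ⟨_, hcomm x y, by simp⟩
  · intro x
    obtain ⟨x, rfl⟩ := hπ x
    exact ⟨_, hpow x, by simp⟩
  · refine ⟨fun h => hM.1 ?_, fun E hE => ?_⟩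
    · rw [← hcomapM, h, Subgroup.comap_top]
    · refine Subgroup.comap_injective hπ ?_
      rw [Subgroup.comap_top]
      refine hM.2 _ (hcomapM.symm.trans_lt ?_)
      exact (Subgroup.comap_lt_comap_of_surjective hπ).2 hE
  · intro h
    refine hPM ?_
    rw [← hcomapM]
    exact Subgroup.map_le_iff_le_comap.1 h
  · refine Subgroup.comap_injective hπ ?_
    rw [Subgroup.comap_inf, hcomapM, hcomapP, MonoidHom.comap_bot, hker]

/-- A proper subgroup of a finite group in `H_p` fixes the origin in an affine action on `ZMod p`
that does not fix it. -/
theorem hasAffineAction_of_ne_top {p : ℕ} [Fact p.Prime] {G : Type*} [Group G] [Finite G]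
    {P H : Subgroup G} [P.Normal] (hP : IsPGroup p P) (hcomm : ∀ x y : G, x * y * x⁻¹ * y⁻¹ ∈ P)
    (hpow : ∀ x : G, x ^ (p - 1) ∈ P) (hH : H ≠ ⊤) : HasAffineAction p H := by
  obtain ⟨M, hM, hle⟩ := (eq_top_or_exists_le_coatom H).resolve_left hH
  exact (hasAffineAction_of_isCoatom hP hcomm hpow hM).mono hle

/-! ### The pro-`H_p` topology -/

/-- The normal subgroups of finite index whose quotient is an extension of a `p`-group by an
abelian group of exponent dividing `p - 1`, described inside the group itself. -/
def IsClassHKernel (p : ℕ) {F : Type*} [Group F] (K : Subgroup F) : Prop :=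
  K.Normal ∧ K.FiniteIndex ∧ ∃ L : Subgroup F, L.Normal ∧ (∀ x ∈ L, ∃ k, x ^ p ^ k ∈ K) ∧
    (∀ x y : F, x * y * x⁻¹ * y⁻¹ ∈ L) ∧ ∀ x : F, x ^ (p - 1) ∈ L

theorem isClassHKernel_of_classH {p : ℕ} {F : Type u} [Group F] {K : Subgroup F} [K.Normal]
    (h : classH p (F ⧸ K)) : IsClassHKernel p K := by
  obtain ⟨N, hN, ⟨hfinN, hpN⟩, hfinQ, hab, hexp⟩ := h
  have hmem : ∀ x : F, (((x : F ⧸ K) : (F ⧸ K) ⧸ N) = 1) → x ∈ N.comap (QuotientGroup.mk' K) :=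
    fun x hx => (QuotientGroup.eq_one_iff (N := N) (x : F ⧸ K)).1 hx
  refine ⟨inferInstance, ?_, N.comap (QuotientGroup.mk' K), inferInstance, ?_, ?_, ?_⟩
  · have : Finite (F ⧸ K) := Finite.of_subgroup_quotient N
    exact Subgroup.finiteIndex_of_finite_quotient
  · intro x hx
    obtain ⟨k, hk⟩ := hpN ⟨(x : F ⧸ K), hx⟩
    refine ⟨k, (QuotientGroup.eq_one_iff _).1 ?_⟩
    exact congrArg Subtype.val hk
  · intro x y
    refine hmem _ ?_
    have := hab ((x : F ⧸ K) : (F ⧸ K) ⧸ N) ((y : F ⧸ K) : (F ⧸ K) ⧸ N)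
    simp only [QuotientGroup.mk_mul, QuotientGroup.mk_inv]
    rw [this]
    group
  · intro x
    refine hmem _ ?_
    simpa using hexp ((x : F ⧸ K) : (F ⧸ K) ⧸ N)

theorem IsClassHKernel.inf {p : ℕ} {F : Type*} [Group F] {K₁ K₂ : Subgroup F}
    (h₁ : IsClassHKernel p K₁) (h₂ : IsClassHKernel p K₂) : IsClassHKernel p (K₁ ⊓ K₂) := by
  obtain ⟨_, _, L₁, _, hp₁, hc₁, he₁⟩ := h₁
  obtain ⟨_, _, L₂, _, hp₂, hc₂, he₂⟩ := h₂
  refine ⟨inferInstance, inferInstance, L₁ ⊓ L₂, inferInstance, fun x hx => ?_,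
    fun x y => ⟨hc₁ x y, hc₂ x y⟩, fun x => ⟨he₁ x, he₂ x⟩⟩
  obtain ⟨k, hk⟩ := hp₁ x hx.1
  obtain ⟨l, hl⟩ := hp₂ x hx.2
  refine ⟨k + l, ?_, ?_⟩
  · rw [pow_add, pow_mul]
    exact K₁.pow_mem hk _
  · rw [pow_add, mul_comm, pow_mul]
    exact K₂.pow_mem hl _

theorem isClassHKernel_top (p : ℕ) {F : Type*} [Group F] :
    IsClassHKernel p (⊤ : Subgroup F) :=
  ⟨inferInstance, inferInstance, ⊤, inferInstance, fun _ _ => ⟨0, trivial⟩, fun _ _ => trivial,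
    fun _ => trivial⟩

/-- The generating cosets are a priori only a subbasis; stability of the kernels under intersection
gives a coset around each point. -/
theorem exists_coset_subset_of_isOpen {p : ℕ} {F : Type u} [Group F] {U : Set F}
    (hU : @IsOpen F (proTopology (classH.{u} p) F) U) {x : F} (hx : x ∈ U) :
    ∃ K : Subgroup F, IsClassHKernel p K ∧ ∀ k ∈ K, k * x ∈ U := by
  change TopologicalSpace.GenerateOpen _ U at hU
  induction hU with
  | basic S hS =>
    obtain ⟨K, _, y, hK, rfl⟩ := hS
    obtain ⟨l, hl, rfl⟩ := hx
    exact ⟨K, isClassHKernel_of_classH hK, fun k hk => ⟨k * l, K.mul_mem hk hl, mul_assoc _ _ _⟩⟩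
  | univ => exact ⟨⊤, isClassHKernel_top p, fun _ _ => trivial⟩
  | inter S T _ _ ihS ihT =>
    obtain ⟨K₁, h₁, hS⟩ := ihS hx.1
    obtain ⟨K₂, h₂, hT⟩ := ihT hx.2
    exact ⟨K₁ ⊓ K₂, h₁.inf h₂, fun k hk => ⟨hS k hk.1, hT k hk.2⟩⟩
  | sUnion 𝒮 _ ih =>
    obtain ⟨S, hS, hxS⟩ := hx
    obtain ⟨K, hK, h⟩ := ih S hS hxS
    exact ⟨K, hK, fun k hk => ⟨S, hS, h k hk⟩⟩

theorem hasAffineAction_of_not_isDenseIn {p : ℕ} [Fact p.Prime] {F : Type u} [Group F]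
    {H : Subgroup F} (h : ¬ IsDenseIn (classH.{u} p) (H : Set F)) : HasAffineAction p H := by
  obtain ⟨x, hx⟩ := (Set.ne_univ_iff_exists_notMem _).1 h
  let _ : TopologicalSpace F := proTopology (classH.{u} p) F
  have hopen : IsOpen (closure (H : Set F))ᶜ := isClosed_closure.isOpen_compl
  obtain ⟨K, ⟨_, _, L, hLn, hp, hc, he⟩, hK⟩ := exists_coset_subset_of_isOpen hopen hx
  let π := QuotientGroup.mk' K
  have hπ : Function.Surjective π := QuotientGroup.mk'_surjective K
  have hn : (L.map π).Normal := hLn.map π hπ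
  -- Otherwise `H` would meet the coset `Kx`, which misses its closure.
  have hHK : H.map π ≠ ⊤ := fun htop => by
    have hxH : π x ∈ H.map π := htop ▸ Subgroup.mem_top _
    obtain ⟨y, hy, hyx⟩ := hxH
    have hk : y * x⁻¹ ∈ K := by
      rw [← QuotientGroup.ker_mk' K, MonoidHom.mem_ker]
      change π _ = 1
      rw [map_mul, map_inv, hyx, mul_inv_cancel]
    have := hK _ hk
    rw [inv_mul_cancel_right] at this
    exact this (subset_closure hy)
  refine HasAffineAction.mono (Subgroup.le_comap_map π H) (HasAffineAction.comap hπ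
    (hasAffineAction_of_ne_top (P := L.map π) ?_ ?_ ?_ hHK))
  · rintro ⟨_, y, hy, rfl⟩
    obtain ⟨k, hk⟩ := hp y hy
    exact ⟨k, Subtype.ext ((QuotientGroup.eq_one_iff (y ^ p ^ k)).2 hk)⟩
  · intro x y
    obtain ⟨x, rfl⟩ := hπ x
    obtain ⟨y, rfl⟩ := hπ y
    exact ⟨_, hc x y, by simp⟩
  · intro x
    obtain ⟨x, rfl⟩ := hπ x
    exact ⟨_, he x, by simp⟩

/-! ### Affine images lie in `H_p`, and the density criterion -/

/-- The permutation `x ↦ u * x + b` of `ZMod p`. -/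
def affinePerm {p : ℕ} (u : (ZMod p)ˣ) (b : ZMod p) : Equiv.Perm (ZMod p) where
  toFun x := u * x + b
  invFun x := (u⁻¹ : (ZMod p)ˣ) * (x - b)
  left_inv x := by simp
  right_inv x := by simp

/-- The affine action of a group on `ZMod p` with linear part `χ` and translation part `δ`. -/
def affineHom {p : ℕ} {F : Type*} [Group F] (χ : F →* (ZMod p)ˣ) (δ : F → ZMod p)
    (hδ : ∀ g h, δ (g * h) = δ g + χ g * δ h) : F →* Equiv.Perm (ZMod p) :=
  MonoidHom.mk' (fun g => affinePerm (χ g) (δ g)) fun g h => Equiv.ext fun x => by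
    simp only [affinePerm, map_mul, hδ, Units.val_mul, Equiv.coe_fn_mk, Equiv.Perm.mul_apply]
    ring

theorem affineHom_apply {p : ℕ} {F : Type*} [Group F] (χ : F →* (ZMod p)ˣ) (δ : F → ZMod p)
    (hδ : ∀ g h, δ (g * h) = δ g + χ g * δ h) (g : F) (x : ZMod p) :
    affineHom χ δ hδ g x = χ g * x + δ g := rfl

/-- The kernel of `χ` acts by translations, which have order dividing `p`, and modulo it only the
linear part in `(ZMod p)ˣ` remains. -/
theorem classH_quotient_ker_affineHom {p : ℕ} [Fact p.Prime] {F : Type u} [Group F]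
    (χ : F →* (ZMod p)ˣ) (δ : F → ZMod p) (hδ : ∀ g h, δ (g * h) = δ g + χ g * δ h) :
    classH p (F ⧸ (affineHom χ δ hδ).ker) := by
  let K := (affineHom χ δ hδ).ker
  let π := QuotientGroup.mk' K
  have hπ : Function.Surjective π := QuotientGroup.mk'_surjective _
  have hfin : Finite (F ⧸ K) :=
    Finite.of_injective _ (QuotientGroup.kerLift_injective (affineHom χ δ hδ))
  have hn : (χ.ker.map π).Normal := Subgroup.Normal.map inferInstance π hπ
  refine ⟨χ.ker.map π, hn, ⟨inferInstance, ?_⟩, inferInstance, ?_, ?_⟩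
  · rintro ⟨_, g, hg, rfl⟩
    have hg : χ g = 1 := hg
    have hpow : ∀ (k : ℕ) (x : ZMod p), affineHom χ δ hδ (g ^ k) x = x + k * δ g := by
      intro k
      induction k with
      | zero => intro x; simp
      | succ k ih =>
        intro x
        rw [pow_succ, map_mul, Equiv.Perm.mul_apply, ih, affineHom_apply, hg]
        push_cast
        ring
    refine ⟨1, Subtype.ext ((QuotientGroup.eq_one_iff (g ^ p ^ 1)).2 ?_)⟩
    refine MonoidHom.mem_ker.2 (Equiv.ext fun x => ?_)
    rw [pow_one, hpow]
    simp
  · intro x y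
    obtain ⟨x, rfl⟩ := QuotientGroup.mk'_surjective _ x
    obtain ⟨y, rfl⟩ := QuotientGroup.mk'_surjective _ y
    obtain ⟨x, rfl⟩ := hπ x
    obtain ⟨y, rfl⟩ := hπ y
    refine (QuotientGroup.eq (s := χ.ker.map π)).2 ⟨(x * y)⁻¹ * (y * x), ?_, by
      rw [map_mul, map_inv, map_mul, map_mul]⟩
    refine MonoidHom.mem_ker.2 ?_
    rw [map_mul, map_inv, map_mul, map_mul, mul_comm (χ y), inv_mul_cancel]
  · intro x
    obtain ⟨x, rfl⟩ := QuotientGroup.mk'_surjective _ x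
    obtain ⟨x, rfl⟩ := hπ x
    refine (QuotientGroup.eq_one_iff (N := χ.ker.map π) (π x ^ (p - 1))).2
      ⟨x ^ (p - 1), ?_, by simp⟩
    refine MonoidHom.mem_ker.2 ?_
    rw [map_pow, ZMod.units_pow_card_sub_one_eq_one]

/-- A subgroup is `H_p`-dense if and only if it moves the origin in every affine action of the
group on `ZMod p` in which the group does. -/
theorem isDenseIn_classH_iff {p : ℕ} [Fact p.Prime] {F : Type u} [Group F] (H : Subgroup F) :
    IsDenseIn (classH.{u} p) (H : Set F) ↔ ¬ HasAffineAction p H := by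
  refine ⟨fun hd => ?_, fun h => by_contra fun hd => h (hasAffineAction_of_not_isDenseIn hd)⟩
  rintro ⟨χ, δ, hδ, hH, g, hg⟩
  let _ : TopologicalSpace F := proTopology (classH.{u} p) F
  have hgcl : g ∈ closure (H : Set F) := by
    have : closure (H : Set F) = Set.univ := hd
    rw [this]; trivial
  let K := (affineHom χ δ hδ).ker
  have hopen : IsOpen ((fun k => k * g) '' (K : Set F)) :=
    TopologicalSpace.isOpen_generateFrom_of_mem
      ⟨K, inferInstance, g, classH_quotient_ker_affineHom χ δ hδ, rfl⟩
  obtain ⟨_, ⟨k, hk, rfl⟩, hkH⟩ := mem_closure_iff.1 hgcl _ hopen ⟨1, K.one_mem, one_mul g⟩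
  refine hg ?_
  have h0 : ∀ a, affineHom χ δ hδ a 0 = δ a := fun a => by rw [affineHom_apply, mul_zero, zero_add]
  have h1 : affineHom χ δ hδ (k * g) = affineHom χ δ hδ g := by
    rw [map_mul, MonoidHom.mem_ker.1 hk, one_mul]
  rw [← h0, ← h1, h0]
  exact hH _ hkH

/-! ### Affine actions of a free group -/

/-- The action of the free group on `ZMod p` in which the letter `i` acts by
`x ↦ u i * x + b i`. -/
def freeAffineHom {p n : ℕ} (u : Fin n → (ZMod p)ˣ) (b : Fin n → ZMod p) :
    FreeGroup (Fin n) →* Equiv.Perm (ZMod p) :=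
  FreeGroup.lift fun i => affinePerm (u i) (b i)

theorem freeAffineHom_apply {p n : ℕ} (u : Fin n → (ZMod p)ˣ) (b : Fin n → ZMod p)
    (g : FreeGroup (Fin n)) : ∀ x : ZMod p,
    freeAffineHom u b g x = (FreeGroup.lift u g : (ZMod p)ˣ) * x + freeAffineHom u b g 0 := by
  induction g using FreeGroup.induction_on with
  | C1 => intro x; simp
  | of i => intro x; simp [freeAffineHom, affinePerm]
  | inv_of i _ =>
    intro x
    simp only [freeAffineHom, map_inv, FreeGroup.lift_apply_of, affinePerm, Equiv.Perm.inv_def,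
      Equiv.coe_fn_symm_mk]
    ring
  | mul g h ihg ihh =>
    intro x
    simp only [map_mul, Equiv.Perm.mul_apply]
    rw [ihg, ihh, ihg (freeAffineHom u b h 0), Units.val_mul]
    ring

/-- By freeness an action is any choice of affine maps for the letters. The origin is fixed by the
group exactly when every letter fixes it, and by `H` exactly when every generating word does. -/
theorem hasAffineAction_subgroupOfWords_iff {p n : ℕ} (W : List (List (Fin n × Bool))) :
    HasAffineAction p (subgroupOfWords W) ↔
      ∃ (u : Fin n → (ZMod p)ˣ) (b : Fin n → ZMod p),
        (∀ w ∈ W, freeAffineHom u b (FreeGroup.mk w) 0 = 0) ∧ ∃ i, b i ≠ 0 := by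
  constructor
  · rintro ⟨χ, δ, hδ, hH, g, hg⟩
    have hΦ : freeAffineHom (fun i => χ (FreeGroup.of i)) (fun i => δ (FreeGroup.of i)) =
        affineHom χ δ hδ := FreeGroup.ext_hom _ _ fun i => by simp [freeAffineHom, affineHom]
    refine ⟨fun i => χ (FreeGroup.of i), fun i => δ (FreeGroup.of i), fun w hw => ?_, ?_⟩
    · rw [hΦ, affineHom_apply, mul_zero, zero_add]
      exact hH _ (Subgroup.subset_closure ⟨w, hw, rfl⟩)
    · by_contra! hb
      have hδ1 : δ 1 = 0 := by simpa using hδ 1 1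
      refine hg ?_
      clear hg
      induction g using FreeGroup.induction_on with
      | C1 => exact hδ1
      | of i => exact hb i
      | inv_of i _ => simpa [hδ1, hb i] using (hδ (FreeGroup.of i)⁻¹ (FreeGroup.of i)).symm
      | mul g h ihg ihh =>
        rw [hδ, ihg, ihh, mul_zero, add_zero]
  · rintro ⟨u, b, hw, i, hi⟩
    refine ⟨FreeGroup.lift u, fun g => freeAffineHom u b g 0, fun g h => ?_, fun h hh => ?_,
      FreeGroup.of i, ?_⟩
    · change freeAffineHom u b (g * h) 0 = _
      rw [map_mul, Equiv.Perm.mul_apply, freeAffineHom_apply, add_comm]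
    · have hle : subgroupOfWords W ≤
          (MulAction.stabilizer (Equiv.Perm (ZMod p)) (0 : ZMod p)).comap (freeAffineHom u b) := by
        refine (Subgroup.closure_le _).2 ?_
        rintro _ ⟨w, hwW, rfl⟩
        exact hw w hwW
      exact hle hh
    · simpa [freeAffineHom, affinePerm] using hi

/-! ### Coding by base `p` digits -/

/-- The action on (representatives of) `ZMod p` of the letter `a.1`, or of its inverse, when the
letters act by the affine maps whose coefficients are the base `p` digits of `c` and `d`. -/
def evalLetter (p c d : ℕ) (a : ℕ × Bool) (x : ℕ) : ℕ :=
  if a.2 = true then (c / p ^ a.1 % p) * x + d / p ^ a.1 % p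
  else (c / p ^ a.1 % p) ^ (p - 2) * (x + (p - d / p ^ a.1 % p))

/-- The image of the origin under a word, see `evalLetter`. -/
def evalWord (p c d : ℕ) (w : List (ℕ × Bool)) : ℕ :=
  w.foldr (fun a x => evalLetter p c d a x) 0

/-- Some affine action of the free group of rank `n` on `ZMod p` moves the origin while the words
of `W` fix it. -/
def HasAffineWitness (p n : ℕ) (W : List (List (ℕ × Bool))) : Prop :=
  ∃ c < p ^ n, ∃ d < p ^ n, (∀ i < n, c / p ^ i % p ≠ 0) ∧
    (∀ w ∈ W, evalWord p c d w % p = 0) ∧ ∃ i < n, d / p ^ i % p ≠ 0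

theorem cast_evalLetter {p n : ℕ} [Fact p.Prime] {c d : ℕ} {u : Fin n → (ZMod p)ˣ}
    {b : Fin n → ZMod p} (hu : ∀ i : Fin n, ((c / p ^ (i : ℕ) % p : ℕ) : ZMod p) = u i)
    (hb : ∀ i : Fin n, ((d / p ^ (i : ℕ) % p : ℕ) : ZMod p) = b i) (i : Fin n) (ε : Bool) (x : ℕ) :
    (evalLetter p c d (i, ε) x : ZMod p) =
      (cond ε (affinePerm (u i) (b i)) (affinePerm (u i) (b i))⁻¹) (x : ZMod p) := by
  have hp : p.Prime := Fact.out
  cases ε with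
  | true => simp [evalLetter, affinePerm, ← hu, ← hb]
  | false =>
    -- This keeps the subtraction from `p` in `evalLetter` from truncating.
    have hlt : d / p ^ (i : ℕ) % p ≤ p := (Nat.mod_lt _ hp.pos).le
    -- Fermat's inverse; for `p = 2` the exponent is `0` and the only unit is `1`.
    have hinv : ((u i : ZMod p)) ^ (p - 2) = ((u i)⁻¹ : (ZMod p)ˣ) := by
      rw [← Units.val_pow_eq_pow_val, Units.val_inj, eq_inv_iff_mul_eq_one, ← pow_succ,
        show p - 2 + 1 = p - 1 by have := hp.two_le; omega, ZMod.units_pow_card_sub_one_eq_one]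
    simp only [evalLetter, Bool.false_eq_true, if_false, cond_false, affinePerm,
      Equiv.Perm.inv_def, Equiv.coe_fn_symm_mk]
    rw [Nat.cast_mul, Nat.cast_pow, Nat.cast_add, Nat.cast_sub hlt, hu, hb, hinv, ZMod.natCast_self]
    ring

theorem cast_evalWord {p n : ℕ} [Fact p.Prime] {c d : ℕ} {u : Fin n → (ZMod p)ˣ}
    {b : Fin n → ZMod p} (hu : ∀ i : Fin n, ((c / p ^ (i : ℕ) % p : ℕ) : ZMod p) = u i)
    (hb : ∀ i : Fin n, ((d / p ^ (i : ℕ) % p : ℕ) : ZMod p) = b i) (w : List (Fin n × Bool)) :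
    (evalWord p c d (w.map fun a => ((a.1 : ℕ), a.2)) : ZMod p) =
      freeAffineHom u b (FreeGroup.mk w) 0 := by
  rw [freeAffineHom, FreeGroup.lift_mk]
  induction w with
  | nil => simp [evalWord]
  | cons a w ih =>
    rw [List.map_cons, List.map_cons, List.prod_cons, Equiv.Perm.mul_apply, ← ih]
    exact cast_evalLetter hu hb a.1 a.2 _

theorem forall_evalWord_rawWords_iff {p n : ℕ} [Fact p.Prime] {c d : ℕ} {u : Fin n → (ZMod p)ˣ}
    {b : Fin n → ZMod p} (hu : ∀ i : Fin n, ((c / p ^ (i : ℕ) % p : ℕ) : ZMod p) = u i)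
    (hb : ∀ i : Fin n, ((d / p ^ (i : ℕ) % p : ℕ) : ZMod p) = b i)
    (W : List (List (Fin n × Bool))) :
    (∀ w ∈ rawWords W, evalWord p c d w % p = 0) ↔
      ∀ w ∈ W, freeAffineHom u b (FreeGroup.mk w) 0 = 0 := by
  simp only [rawWords, List.forall_mem_map, ← Nat.dvd_iff_mod_eq_zero,
    ← ZMod.natCast_eq_zero_iff, cast_evalWord hu hb]

/-- Every family of residues is given by the base `p` digits of a number. -/
theorem exists_digits {p n : ℕ} [NeZero p] (f : Fin n → ZMod p) :
    ∃ c < p ^ n, ∀ i : Fin n, ((c / p ^ (i : ℕ) % p : ℕ) : ZMod p) = f i := by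
  let e : Fin n → Fin p := fun i => ⟨(f i).val, ZMod.val_lt _⟩
  refine ⟨finFunctionFinEquiv e, (finFunctionFinEquiv e).2, fun i => ?_⟩
  rw [← finFunctionFinEquiv_symm_apply_val, Equiv.symm_apply_apply]
  exact ZMod.natCast_zmod_val (f i)

theorem cast_digit_ne_zero_iff (p c i : ℕ) :
    ((c / p ^ i % p : ℕ) : ZMod p) ≠ 0 ↔ c / p ^ i % p ≠ 0 := by
  rw [Ne, ZMod.natCast_eq_zero_iff, Nat.dvd_iff_mod_eq_zero, Nat.mod_mod]

theorem hasAffineWitness_rawWords_iff {p n : ℕ} [Fact p.Prime] (W : List (List (Fin n × Bool))) :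
    HasAffineWitness p n (rawWords W) ↔ HasAffineAction p (subgroupOfWords W) := by
  rw [hasAffineAction_subgroupOfWords_iff]
  constructor
  · rintro ⟨c, -, d, -, hc, hW, i, hi, hdi⟩
    let u : Fin n → (ZMod p)ˣ := fun i =>
      Units.mk0 ((c / p ^ (i : ℕ) % p : ℕ) : ZMod p) ((cast_digit_ne_zero_iff p c i).2 (hc i i.2))
    exact ⟨u, fun i => ((d / p ^ (i : ℕ) % p : ℕ) : ZMod p),
      (forall_evalWord_rawWords_iff (fun i => rfl) (fun i => rfl) W).1 hW,
      ⟨i, hi⟩, (cast_digit_ne_zero_iff p d i).2 hdi⟩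
  · rintro ⟨u, b, hW, i, hi⟩
    obtain ⟨c, hc, hcu⟩ := exists_digits fun i => (u i : ZMod p)
    obtain ⟨d, hd, hdb⟩ := exists_digits b
    refine ⟨c, hc, d, hd, fun j hj => (cast_digit_ne_zero_iff p c j).1 ?_,
      (forall_evalWord_rawWords_iff hcu hdb W).2 hW, i, i.2,
      (cast_digit_ne_zero_iff p d i).1 (by rwa [hdb i])⟩
    rw [hcu ⟨j, hj⟩]
    exact (u ⟨j, hj⟩).ne_zero

/-! ### Primitive recursiveness of the search -/

theorem primrec₂_pow : Primrec₂ ((· ^ ·) : ℕ → ℕ → ℕ) :=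
  Primrec₂.unpaired'.1 Nat.Primrec.pow

theorem primrecRel_exists_lt {β : Type*} [Primcodable β] {R : ℕ → β → Prop} (hR : PrimrecRel R) :
    PrimrecRel fun n y => ∃ x < n, R x y :=
  (hR.exists_mem_list.comp (Primrec.list_range.comp Primrec.fst) Primrec.snd).of_eq (by simp)

theorem primrecRel_forall_lt {β : Type*} [Primcodable β] {R : ℕ → β → Prop} (hR : PrimrecRel R) :
    PrimrecRel fun n y => ∀ x < n, R x y :=
  (hR.forall_mem_list.comp (Primrec.list_range.comp Primrec.fst) Primrec.snd).of_eq (by simp)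

theorem primrec_digit {α : Type*} [Primcodable α] {p c i : α → ℕ} (hp : Primrec p)
    (hc : Primrec c) (hi : Primrec i) : Primrec fun a => c a / p a ^ i a % p a :=
  Primrec.nat_mod.comp (Primrec.nat_div.comp hc (primrec₂_pow.comp hp hi)) hp

theorem primrec_evalLetter {α : Type*} [Primcodable α] {p c d x : α → ℕ} {l : α → ℕ × Bool}
    (hp : Primrec p) (hc : Primrec c) (hd : Primrec d) (hl : Primrec l) (hx : Primrec x) :
    Primrec fun a => evalLetter (p a) (c a) (d a) (l a) (x a) := by
  have hu := primrec_digit hp hc (Primrec.fst.comp hl)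
  have hb := primrec_digit hp hd (Primrec.fst.comp hl)
  exact Primrec.ite (Primrec.eq.comp (Primrec.snd.comp hl) (Primrec.const true))
    (Primrec.nat_add.comp (Primrec.nat_mul.comp hu hx) hb)
    (Primrec.nat_mul.comp (primrec₂_pow.comp hu (Primrec.nat_sub.comp hp (Primrec.const 2)))
      (Primrec.nat_add.comp hx (Primrec.nat_sub.comp hp hb)))

theorem primrec_evalWord {α : Type*} [Primcodable α] {p c d : α → ℕ} {w : α → List (ℕ × Bool)}
    (hp : Primrec p) (hc : Primrec c) (hd : Primrec d) (hw : Primrec w) :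
    Primrec fun a => evalWord (p a) (c a) (d a) (w a) :=
  Primrec.list_foldr hw (Primrec.const 0)
    (h := fun a q => evalLetter (p a) (c a) (d a) q.1 q.2)
    (primrec_evalLetter (hp.comp Primrec.fst) (hc.comp Primrec.fst) (hd.comp Primrec.fst)
      (Primrec.fst.comp Primrec.snd) (Primrec.snd.comp Primrec.snd))

theorem primrecPred_hasAffineWitness :
    PrimrecPred fun q : ℕ × ℕ × List (List (ℕ × Bool)) => HasAffineWitness q.1 q.2.1 q.2.2 := by
  have hdigit : PrimrecRel fun (i : ℕ) (q : ℕ × ℕ × ℕ) => q.2.2 / q.1 ^ i % q.1 ≠ 0 :=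
    (Primrec.eq.comp (primrec_digit (Primrec.fst.comp Primrec.snd)
      (Primrec.snd.comp (Primrec.snd.comp Primrec.snd)) Primrec.fst) (Primrec.const 0)).not
  have hunits : PrimrecPred fun q : ℕ × ℕ × ℕ => ∀ i < q.2.1, q.2.2 / q.1 ^ i % q.1 ≠ 0 := by
    have h := primrecRel_forall_lt hdigit
    exact h.comp (Primrec.fst.comp Primrec.snd) Primrec.id
  have hmoved : PrimrecPred fun q : ℕ × ℕ × ℕ => ∃ i < q.2.1, q.2.2 / q.1 ^ i % q.1 ≠ 0 :=
    (primrecRel_exists_lt hdigit).comp (f := fun q : ℕ × ℕ × ℕ => q.2.1) (g := fun q => q)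
      (Primrec.fst.comp Primrec.snd) Primrec.id
  -- Here `q` is `(p, c, d)`, whereas above it is `(p, n, c)` or `(p, n, d)`.
  have hwords : PrimrecRel fun (W : List (List (ℕ × Bool))) (q : ℕ × ℕ × ℕ) =>
      ∀ w ∈ W, evalWord q.1 q.2.1 q.2.2 w % q.1 = 0 := by
    have h : PrimrecRel fun (w : List (ℕ × Bool)) (q : ℕ × ℕ × ℕ) =>
        evalWord q.1 q.2.1 q.2.2 w % q.1 = 0 :=
      Primrec.eq.comp (Primrec.nat_mod.comp (primrec_evalWord (Primrec.fst.comp Primrec.snd)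
        (Primrec.fst.comp (Primrec.snd.comp Primrec.snd))
        (Primrec.snd.comp (Primrec.snd.comp Primrec.snd)) Primrec.fst)
        (Primrec.fst.comp Primrec.snd)) (Primrec.const 0)
    exact h.forall_mem_list
  have hbound : Primrec fun q : ℕ × ℕ × List (List (ℕ × Bool)) => q.1 ^ q.2.1 :=
    primrec₂_pow.comp Primrec.fst (Primrec.fst.comp Primrec.snd)
  -- The parameters `r` of the inner search for `d` are `(c, p, n, W)`.
  have hbody : PrimrecRel fun (d : ℕ) (r : ℕ × ℕ × ℕ × List (List (ℕ × Bool))) =>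
      (∀ i < r.2.2.1, r.1 / r.2.1 ^ i % r.2.1 ≠ 0) ∧
        (∀ w ∈ r.2.2.2, evalWord r.2.1 r.1 d w % r.2.1 = 0) ∧
          ∃ i < r.2.2.1, d / r.2.1 ^ i % r.2.1 ≠ 0 := by
    have hc : Primrec fun s : ℕ × ℕ × ℕ × ℕ × List (List (ℕ × Bool)) => s.2.1 :=
      Primrec.fst.comp Primrec.snd
    have hp : Primrec fun s : ℕ × ℕ × ℕ × ℕ × List (List (ℕ × Bool)) => s.2.2.1 :=
      Primrec.fst.comp (Primrec.snd.comp Primrec.snd)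
    have hn : Primrec fun s : ℕ × ℕ × ℕ × ℕ × List (List (ℕ × Bool)) => s.2.2.2.1 :=
      Primrec.fst.comp (Primrec.snd.comp (Primrec.snd.comp Primrec.snd))
    have hW : Primrec fun s : ℕ × ℕ × ℕ × ℕ × List (List (ℕ × Bool)) => s.2.2.2.2 :=
      Primrec.snd.comp (Primrec.snd.comp (Primrec.snd.comp Primrec.snd))
    exact (hunits.comp (hp.pair (hn.pair hc))).and
      ((hwords.comp hW (hp.pair (hc.pair Primrec.fst))).and
        (hmoved.comp (hp.pair (hn.pair Primrec.fst))))
  have hexists : PrimrecRel fun (c : ℕ) (q : ℕ × ℕ × List (List (ℕ × Bool))) =>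
      ∃ d < q.1 ^ q.2.1, (∀ i < q.2.1, c / q.1 ^ i % q.1 ≠ 0) ∧
        (∀ w ∈ q.2.2, evalWord q.1 c d w % q.1 = 0) ∧ ∃ i < q.2.1, d / q.1 ^ i % q.1 ≠ 0 :=
    (primrecRel_exists_lt hbody).comp
      (f := fun s : ℕ × ℕ × ℕ × List (List (ℕ × Bool)) => s.2.1 ^ s.2.2.1) (g := fun s => s)
      (hbound.comp Primrec.snd) Primrec.id
  exact (primrecRel_exists_lt hexists).comp
    (f := fun q : ℕ × ℕ × List (List (ℕ × Bool)) => q.1 ^ q.2.1) (g := fun q => q)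
    hbound Primrec.id

end ProV

theorem mainTheorem6 :
    ∃ decide : ℕ × ℕ × List (List (ℕ × Bool)) → Bool,
      Computable decide ∧
        ∀ (p n : ℕ) (W : List (List (Fin n × Bool))), p.Prime →
          (decide (p, n, ProV.rawWords W) = true ↔
            ProV.IsDenseIn (ProV.classH p)
              (ProV.subgroupOfWords W : Set (FreeGroup (Fin n)))) := by
  classical
  refine ⟨fun q => decide ¬ ProV.HasAffineWitness q.1 q.2.1 q.2.2,
    ProV.primrecPred_hasAffineWitness.not.decide.to_comp, fun p n W hp => ?_⟩
  have : Fact p.Prime := ⟨hp⟩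
  rw [decide_eq_true_iff, ProV.isDenseIn_classH_iff, ProV.hasAffineWitness_rawWords_iff]
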